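/- **Language.** A predicate signature $\Theta$ consists of a non-empty set of predicate symbols of arity $\ge 1$ and a set $C$ of individual constants (no function symbols, no equality). Formulas are built from atoms $P\tau_1\dots\tau_n$ (terms are variables or constants; there are countably many variables) by $\neg,\Box,\to,\forall x$; $\exists x\varphi$ abbreviates $\neg\forall x\neg\varphi$. Two formulas are *variants*, $\varphi\sim\psi$, if one arises from the other by adding or deleting void quantifiers $\forall x,\exists x$ and renaming bound variables (anywhere in the formula). For a constant $c$, $\varphi(c)$ denotes $\varphi[x/c]$. **Semantics.** The truth values are $\mathsf T,\mathsf t,\mathsf f,\mathsf F$; $\mathsf T,\mathsf t$ are designated. The multioperators are: $\tilde\neg\mathsf T=\{\mathsf F\}$, $\tilde\neg\mathsf t=\{\mathsf f\}$, $\tilde\neg\mathsf f=\{\mathsf t\}$, $\tilde\neg\mathsf F=\{\mathsf T\}$; $\tilde\Box\mathsf T=\{\mathsf T,\mathsf t\}$ and $\tilde\Box a=\{\mathsf f,\mathsf F\}$ for $a\ne\mathsf T$; $a\,\tilde\to\,\mathsf T=\mathsf F\,\tilde\to\,a=\{\mathsf T\}$ for all $a$; $\mathsf T\,\tilde\to\,a=\{a\}$;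 $\mathsf t\,\tilde\to\,\mathsf t=\mathsf f\,\tilde\to\,\mathsf t=\mathsf f\,\tilde\to\,\mathsf f=\{\mathsf T,\mathsf t\}$; $\mathsf t\,\tilde\to\,\mathsf f=\mathsf t\,\tilde\to\,\mathsf F=\{\mathsf f\}$; $\mathsf f\,\tilde\to\,\mathsf F=\{\mathsf t\}$; and $\tilde\forall(X)=\{\min X\}$ in the order $\mathsf F<\mathsf f<\mathsf t<\mathsf T$. A structure $\mathfrak A$ has a non-empty domain $U$, functions $P^{\mathfrak A}:U^n\to\{\mathsf T,\mathsf t,\mathsf f,\mathsf F\}$ and elements $c^{\mathfrak A}\in U$. Let $\Theta_U$ be $\Theta$ with a new constant, denoting $a$, for each $a\in U$ not denoted by a constant of $\Theta$. A Tm*-valuation over $\mathfrak A$ is a map $v$ from closed formulas of $\Theta_U$ to truth values with $v(Pc_1\dots c_n)=P^{\mathfrak A}(c_1^{\mathfrak A},\dots,c_n^{\mathfrak A})$, $v(\neg\varphi)\in\tilde\neg v(\varphi)$, $v(\Box\varphi)\in\tilde\Box v(\varphi)$, $v(\varphi\to\psi)\in v(\varphi)\,\tilde\to\,v(\psi)$,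 $v(\forall x\varphi)\in\tilde\forall\{v(\varphi[x/c]) : c \text{ a constant of }\Theta_U\}$, and $v(\varphi)=v(\psi)$ whenever $\varphi\sim\psi$. $\Gamma\models_{\mathrm{Tm}^*}\varphi$ means that for all $\mathfrak A$ and $v$, if every substitution instance of every formula in $\Gamma$ by constants of $\Theta_U$ for its free variables has a designated value, then so does every such instance of $\varphi$. **Tableaux.** Add to $\Theta$ countably many new constants $\bar C$. Signed formulas are $L{:}\varphi$ with $L$ a truth value. The rules are ("$\mid$" splits the branch, "," adds several entries): - $\mathsf T{:}\neg\varphi/\mathsf F{:}\varphi$; $\ \mathsf t{:}\neg\varphi/\mathsf f{:}\varphi$; $\ \mathsf f{:}\neg\varphi/\mathsf t{:}\varphi$; $\ \mathsf F{:}\neg\varphi/\mathsf T{:}\varphi$; - $\mathsf T{:}\Box\varphi/\mathsf T{:}\varphi$; $\ \mathsf t{:}\Box\varphi/\mathsf T{:}\varphi$; $\ \mathsf f{:}\Box\varphi$ and $\mathsf F{:}\Box\varphi$ give $\mathsf t{:}\varphi\mid\mathsf f{:}\varphi\mid\mathsf F{:}\varphi$; - $\mathsf T{:}(\varphi\to\psi)$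 gives $\mathsf F{:}\varphi\mid\mathsf t{:}\varphi,\mathsf t{:}\psi\mid\mathsf f{:}\varphi,\mathsf t{:}\psi\mid\mathsf f{:}\varphi,\mathsf f{:}\psi\mid\mathsf T{:}\psi$; - $\mathsf t{:}(\varphi\to\psi)$ gives $\mathsf T{:}\varphi,\mathsf t{:}\psi\mid\mathsf t{:}\varphi,\mathsf t{:}\psi\mid\mathsf f{:}\varphi,\mathsf t{:}\psi\mid\mathsf f{:}\varphi,\mathsf f{:}\psi\mid\mathsf f{:}\varphi,\mathsf F{:}\psi$; - $\mathsf f{:}(\varphi\to\psi)$ gives $\mathsf T{:}\varphi,\mathsf f{:}\psi\mid\mathsf t{:}\varphi,\mathsf f{:}\psi\mid\mathsf t{:}\varphi,\mathsf F{:}\psi$; $\ \mathsf F{:}(\varphi\to\psi)$ gives $\mathsf T{:}\varphi,\mathsf F{:}\psi$; - $\mathsf T{:}\forall x\varphi/\mathsf T{:}\varphi(c)$ for any constant $c$, reusable; - $\mathsf F{:}\forall x\varphi/\mathsf F{:}\varphi(c)$ with $c$ new to the branch, at most once per branch; - $\mathsf t{:}\forall x\varphi$, first use on a branch: $\mathsf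 t{:}\varphi(c),\mathsf t{:}\varphi(c')\mid\mathsf t{:}\varphi(c),\mathsf T{:}\varphi(c')$ with $c$ new to the branch and any $c'\ne c$; the mark $[c]$ is then kept for $\mathsf t{:}\forall x\varphi$ on both branches, and every later use gives $\mathsf t{:}\varphi(c'')\mid\mathsf T{:}\varphi(c'')$ for any $c''\ne c$; - $\mathsf f{:}\forall x\varphi$, first use on a branch: $\mathsf f{:}\varphi(c),\mathsf f{:}\varphi(c')\mid\mathsf f{:}\varphi(c),\mathsf T{:}\varphi(c')\mid\mathsf f{:}\varphi(c),\mathsf t{:}\varphi(c')$ with $c$ new to the branch and any $c'\ne c$; the mark $[c]$ is then kept, and every later use gives $\mathsf f{:}\varphi(c'')\mid\mathsf T{:}\varphi(c'')\mid\mathsf t{:}\varphi(c'')$ for any $c''\ne c$. A branch is closed if it contains $L{:}\varphi$ and $L'{:}\varphi'$ with $\varphi\sim\varphi'$ and $L\neq L'$; a finite tableau is closed if all its branches are. A closed formula $\varphi$ over $\Theta$ is provable if for each $L\in\{\mathsf F,\mathsf f\}$ there is a finite closed tableau starting from $L{:}\varphi$; $\varphi$ is provable from a finite set $\Gamma$ of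 closed formulas if, for every enumeration $\gamma_1,\dots,\gamma_n$ of $\Gamma$, the formula $\gamma_1\to(\gamma_2\to\cdots\to(\gamma_n\to\varphi)\cdots)$ is provable. **Theorem (completeness of tableaux for Tm\*).** Let $\Gamma\cup\{\varphi\}$ be a finite set of closed formulas over $\Theta$. If $\Gamma\models_{\mathrm{Tm}^*}\varphi$, then $\varphi$ is provable from $\Gamma$ by tableaux in Tm\*. -/

import Mathlib

namespace TmStar

universe u w

/-- The four truth values: necessarily true, contingently true, contingently false,
necessarily false. -/
inductive Val : Type
  | T
  | t
  | f
  | F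

/-- The designated truth values. -/
def Designated (a : Val) : Prop := a = Val.T ∨ a = Val.t

/-- The multioperator for negation. -/
def negOp : Val → Set Val
  | .T => {.F}
  | .t => {.f}
  | .f => {.t}
  | .F => {.T}

/-- The multioperator for necessity (the table of the logic Tm). -/
def boxOp : Val → Set Val
  | .T => {.T, .t}
  | .t => {.f, .F}
  | .f => {.f, .F}
  | .F => {.f, .F}

/-- The multioperator for implication. -/
def impOp : Val → Val → Set Val
  | .T, .T => {.T}
  | .T, .t => {.t}
  | .T, .f => {.f}
  | .T, .F => {.F}
  | .t, .T => {.T}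
  | .t, .t => {.T, .t}
  | .t, .f => {.f}
  | .t, .F => {.f}
  | .f, .T => {.T}
  | .f, .t => {.T, .t}
  | .f, .f => {.T, .t}
  | .f, .F => {.t}
  | .F, _ => {.T}

open Classical in
/-- The (deterministic) multioperator for the universal quantifier: the minimum of the nonempty
set `X` of values in the chain `F ≤ f ≤ t ≤ T`. -/
noncomputable def allOp (X : Set Val) : Set Val :=
  if Val.F ∈ X then {.F} else if Val.f ∈ X then {.f} else if Val.t ∈ X then {.t} else {.T}

/-- Predicate signatures: predicate symbols of positive arity and individual constants
(no function symbols, no equality). -/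
structure Signature where
  Pred : Type w
  Const : Type u
  arity : Pred → ℕ
  pred_nonempty : Nonempty Pred
  arity_pos : ∀ P, 1 ≤ arity P

/-- Terms with constants from `K`; the variables are indexed by `ℕ`. -/
inductive Term (K : Type u) : Type u
  | var : ℕ → Term K
  | const : K → Term K

/-- Formulas with the predicate symbols of `Θ` and with constants from `K`.
`Formula Θ Θ.Const` is the set of formulas over `Θ`, and `Formula Θ (Θ.Const ⊕ D)` is the set of
formulas over the signature obtained from `Θ` by adding the set `D` of new constants. -/
inductive Formula (Θ : Signature.{u, w}) (K : Type u) : Type (max u w)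
  | atom : (P : Θ.Pred) → (Fin (Θ.arity P) → Term K) → Formula Θ K
  | neg : Formula Θ K → Formula Θ K
  | box : Formula Θ K → Formula Θ K
  | imp : Formula Θ K → Formula Θ K → Formula Θ K
  | all : ℕ → Formula Θ K → Formula Θ K

section Language

variable {Θ : Signature.{u, w}} {K K' : Type u}

/-- Renaming of constants in a term. -/
def Term.map (g : K → K') : Term K → Term K'
  | .var x => .var x
  | .const c => .const (g c)

/-- Simultaneous substitution in a term. -/
def Term.subst (s : ℕ → Term K) : Term K → Term K
  | .var x => s x
  | .const c => .const c

namespace Formula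

/-- Renaming of constants; used to read a formula over `Θ` as a formula over a signature
with more constants. -/
def map (g : K → K') : Formula Θ K → Formula Θ K'
  | atom P ts => atom P (fun i => (ts i).map g)
  | neg φ => neg (φ.map g)
  | box φ => box (φ.map g)
  | imp φ ψ => imp (φ.map g) (ψ.map g)
  | all x φ => all x (φ.map g)

/-- `φ.Free x`: the variable `x` occurs free in `φ`. -/
def Free (x : ℕ) : Formula Θ K → Prop
  | atom _ ts => ∃ i, ts i = Term.var x
  | neg φ => φ.Free x
  | box φ => φ.Free x
  | imp φ ψ => φ.Free x ∨ ψ.Free x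
  | all y φ => x ≠ y ∧ φ.Free x

/-- Closed formulas (sentences). -/
def Closed (φ : Formula Θ K) : Prop := ∀ x, ¬ φ.Free x

/-- `φ.Occurs c`: the constant `c` occurs in `φ`. -/
def Occurs (c : K) : Formula Θ K → Prop
  | atom _ ts => ∃ i, ts i = Term.const c
  | neg φ => φ.Occurs c
  | box φ => φ.Occurs c
  | imp φ ψ => φ.Occurs c ∨ ψ.Occurs c
  | all _ φ => φ.Occurs c

/-- Simultaneous replacement of the free occurrences of each variable `x` by the term `s x`. -/
def subst (s : ℕ → Term K) : Formula Θ K → Formula Θ K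
  | atom P ts => atom P (fun i => (ts i).subst s)
  | neg φ => neg (φ.subst s)
  | box φ => box (φ.subst s)
  | imp φ ψ => imp (φ.subst s) (ψ.subst s)
  | all x φ => all x (φ.subst (Function.update s x (.var x)))

/-- `φ[x/τ]`: replacement of the free occurrences of `x` by the term `τ`. -/
def subst₁ (φ : Formula Θ K) (x : ℕ) (τ : Term K) : Formula Θ K :=
  φ.subst (Function.update Term.var x τ)

/-- `φ[x/c]` for a constant `c`. -/
def inst (φ : Formula Θ K) (x : ℕ) (c : K) : Formula Θ K := φ.subst₁ x (.const c)

/-- `φ.FreeFor x y`: the variable `y` is free for `x` in `φ`, i.e. no free occurrence of `x` in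
`φ` lies in the scope of a quantifier binding `y`. -/
def FreeFor (x y : ℕ) : Formula Θ K → Prop
  | atom _ _ => True
  | neg φ => φ.FreeFor x y
  | box φ => φ.FreeFor x y
  | imp φ ψ => φ.FreeFor x y ∧ ψ.FreeFor x y
  | all z φ => (all z φ).Free x → z ≠ y ∧ φ.FreeFor x y

/-- The existential quantifier is an abbreviation. -/
def ex (x : ℕ) (φ : Formula Θ K) : Formula Θ K := neg (all x (neg φ))

/-- `φ` and `ψ` are variants of each other: one is obtained from the other by adding or deleting
void quantifiers (universal or existential) and by renaming bound variables, at any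
positions in the formula. -/
inductive Variant : Formula Θ K → Formula Θ K → Prop
  | refl (φ) : Variant φ φ
  | symm {φ ψ} : Variant φ ψ → Variant ψ φ
  | trans {φ ψ χ} : Variant φ ψ → Variant ψ χ → Variant φ χ
  | void_all {x : ℕ} {φ} : ¬ φ.Free x → Variant (all x φ) φ
  | void_ex {x : ℕ} {φ} : ¬ φ.Free x → Variant (ex x φ) φ
  | rename {x y : ℕ} {φ} : ¬ φ.Free y → φ.FreeFor x y →
      Variant (all x φ) (all y (φ.subst₁ x (.var y)))
  | neg {φ ψ} : Variant φ ψ → Variant (neg φ) (neg ψ)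
  | box {φ ψ} : Variant φ ψ → Variant (box φ) (box ψ)
  | imp {φ φ' ψ ψ'} : Variant φ φ' → Variant ψ ψ' → Variant (imp φ ψ) (imp φ' ψ')
  | all {x : ℕ} {φ ψ} : Variant φ ψ → Variant (all x φ) (all x ψ)

end Formula

end Language

/-- Four-valued modal structures over `Θ`. -/
structure ModalStructure (Θ : Signature.{u, w}) where
  U : Type u
  nonempty : Nonempty U
  pred : (P : Θ.Pred) → (Fin (Θ.arity P) → U) → Val
  const : Θ.Const → U

namespace ModalStructure

variable {Θ : Signature.{u, w}}

/-- The constants of the diagram signature: those of `Θ` together with a new constant for each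
element of the domain that is not the interpretation of a constant of `Θ`. -/
def DiagConst (A : ModalStructure Θ) : Type u := Θ.Const ⊕ {a : A.U // a ∉ Set.range A.const}

/-- Interpretation of the constants of the diagram signature. -/
def interp (A : ModalStructure Θ) : A.DiagConst → A.U
  | Sum.inl c => A.const c
  | Sum.inr a => a.1

/-- A formula over `Θ` read over the diagram signature. -/
def lift (A : ModalStructure Θ) (φ : Formula Θ Θ.Const) : Formula Θ A.DiagConst :=
  φ.map Sum.inl

/-- `v` is a Tm*-valuation over `A`. Only the values of `v` at closed formulas matter: the
values at formulas with free variables are unconstrained and never used. -/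
structure IsValuation (A : ModalStructure Θ) (v : Formula Θ A.DiagConst → Val) : Prop where
  atom : ∀ (P : Θ.Pred) (c : Fin (Θ.arity P) → A.DiagConst),
    v (.atom P (fun i => .const (c i))) = A.pred P (fun i => A.interp (c i))
  neg : ∀ φ, φ.Closed → v (.neg φ) ∈ negOp (v φ)
  box : ∀ φ, φ.Closed → v (.box φ) ∈ boxOp (v φ)
  imp : ∀ φ ψ, φ.Closed → ψ.Closed → v (.imp φ ψ) ∈ impOp (v φ) (v ψ)
  all : ∀ x φ, (Formula.all x φ).Closed →
    v (.all x φ) ∈ allOp (Set.range fun c : A.DiagConst => v (φ.inst x c))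
  variant : ∀ φ ψ, φ.Closed → ψ.Closed → φ.Variant ψ → v φ = v ψ

end ModalStructure

/-- Semantic consequence in Tm*, for arbitrary (possibly open) formulas over `Θ`: for every
structure and valuation, if all closed instances of all the formulas in `Γ` are designated then
so are all closed instances of `φ`. -/
def SemCons {Θ : Signature.{u, w}} (Γ : Set (Formula Θ Θ.Const)) (φ : Formula Θ Θ.Const) : Prop :=
  ∀ (A : ModalStructure Θ) (v : Formula Θ A.DiagConst → Val), A.IsValuation v →
    (∀ γ ∈ Γ, ∀ s : ℕ → A.DiagConst,
      Designated (v ((A.lift γ).subst fun n => .const (s n)))) →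
    ∀ s : ℕ → A.DiagConst, Designated (v ((A.lift φ).subst fun n => .const (s n)))

section Tableaux

variable {Θ : Signature.{u, w}} {K : Type u}

/-- The entries of a branch: signed formulas `L:φ`, and marks. The mark `L:∀xφ:[c]` records that
the rule for `L:∀xφ`, where `L` is `t`, `f` or `F`, has been used for the first time on the
branch, with the fresh constant `c`. -/
inductive Node (Θ : Signature.{u, w}) (K : Type u) : Type (max u w)
  | signed : Val → Formula Θ K → Node Θ K
  | marked : Val → ℕ → Formula Θ K → K → Node Θ K

/-- The constant `c` appears in an entry of a branch. -/
def Node.Occurs (c : K) : Node Θ K → Prop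
  | .signed _ φ => φ.Occurs c
  | .marked _ _ φ d => φ.Occurs c ∨ c = d

/-- The constant `c` has not yet appeared in the branch `θ`. -/
def Fresh (c : K) (θ : List (Node Θ K)) : Prop := ∀ N ∈ θ, ¬ N.Occurs c

/-- A branch is closed if it contains two variant formulas with different signs. -/
def BranchClosed (θ : List (Node Θ K)) : Prop :=
  ∃ L L' φ φ', Node.signed L φ ∈ θ ∧ Node.signed L' φ' ∈ θ ∧ φ.Variant φ' ∧ L ≠ L'

open Node Val Formula in
/-- The tableau rules of Tm*: `Rule θ [e₁, …, eₙ]` says that one rule application to an entry of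
the branch `θ` splits it into the branches obtained by appending `e₁`, …, `eₙ` to `θ`. -/
inductive Rule (θ : List (Node Θ K)) : List (List (Node Θ K)) → Prop
  | neg_T {φ} : signed T (neg φ) ∈ θ → Rule θ [[signed F φ]]
  | neg_t {φ} : signed t (neg φ) ∈ θ → Rule θ [[signed f φ]]
  | neg_f {φ} : signed f (neg φ) ∈ θ → Rule θ [[signed t φ]]
  | neg_F {φ} : signed F (neg φ) ∈ θ → Rule θ [[signed T φ]]
  | box_T {φ} : signed T (box φ) ∈ θ → Rule θ [[signed T φ]]
  | box_t {φ} : signed t (box φ) ∈ θ → Rule θ [[signed T φ]]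
  | box_f {φ} : signed f (box φ) ∈ θ → Rule θ [[signed t φ], [signed f φ], [signed F φ]]
  | box_F {φ} : signed F (box φ) ∈ θ → Rule θ [[signed t φ], [signed f φ], [signed F φ]]
  | imp_T {φ ψ} : signed T (imp φ ψ) ∈ θ → Rule θ
      [[signed F φ], [signed t φ, signed t ψ], [signed f φ, signed t ψ],
        [signed f φ, signed f ψ], [signed T ψ]]
  | imp_t {φ ψ} : signed t (imp φ ψ) ∈ θ → Rule θ
      [[signed T φ, signed t ψ], [signed t φ, signed t ψ], [signed f φ, signed t ψ],
        [signed f φ, signed f ψ], [signed f φ, signed F ψ]]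
  | imp_f {φ ψ} : signed f (imp φ ψ) ∈ θ → Rule θ
      [[signed T φ, signed f ψ], [signed t φ, signed f ψ], [signed t φ, signed F ψ]]
  | imp_F {φ ψ} : signed F (imp φ ψ) ∈ θ → Rule θ [[signed T φ, signed F ψ]]
  | all_T {x φ} (c : K) : signed T (all x φ) ∈ θ → Rule θ [[signed T (φ.inst x c)]]
  /- first use of the rule for `t:∀xφ` on the branch, with fresh `c` and any `c' ≠ c` -/
  | all_t {x φ} (c c' : K) : signed t (all x φ) ∈ θ → (∀ d, marked t x φ d ∉ θ) →
      Fresh c θ → c' ≠ c → Rule θ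
      [[signed t (φ.inst x c), signed t (φ.inst x c'), marked t x φ c],
        [signed t (φ.inst x c), signed T (φ.inst x c'), marked t x φ c]]
  /- reuse of the rule for `t:∀xφ` -/
  | reuse_t {x φ c} (c' : K) : marked t x φ c ∈ θ → c' ≠ c → Rule θ
      [[signed t (φ.inst x c')], [signed T (φ.inst x c')]]
  /- first use of the rule for `f:∀xφ` on the branch, with fresh `c` and any `c' ≠ c` -/
  | all_f {x φ} (c c' : K) : signed f (all x φ) ∈ θ → (∀ d, marked f x φ d ∉ θ) →
      Fresh c θ → c' ≠ c → Rule θ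
      [[signed f (φ.inst x c), signed f (φ.inst x c'), marked f x φ c],
        [signed f (φ.inst x c), signed T (φ.inst x c'), marked f x φ c],
        [signed f (φ.inst x c), signed t (φ.inst x c'), marked f x φ c]]
  /- reuse of the rule for `f:∀xφ` -/
  | reuse_f {x φ c} (c' : K) : marked f x φ c ∈ θ → c' ≠ c → Rule θ
      [[signed f (φ.inst x c')], [signed T (φ.inst x c')], [signed t (φ.inst x c')]]
  /- the rule for `F:∀xφ`, used at most once on each branch -/
  | all_F {x φ} (c : K) : signed F (all x φ) ∈ θ → (∀ d, marked F x φ d ∉ θ) →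
      Fresh c θ → Rule θ [[signed F (φ.inst x c), marked F x φ c]]

/-- Finite tableaux extending the branch `θ`: trees generated by applying rules to branches. -/
inductive Tableau : List (Node Θ K) → Type (max u w)
  | leaf (θ : List (Node Θ K)) : Tableau θ
  | step (θ : List (Node Θ K)) (es : List (List (Node Θ K))) (h : Rule θ es)
      (child : (i : Fin es.length) → Tableau (θ ++ es.get i)) : Tableau θ

/-- A tableau is closed if all its branches are closed. -/
def Tableau.Closed : {θ : List (Node Θ K)} → Tableau θ → Prop
  | _, .leaf θ => BranchClosed θ
  | _, .step _ _ _ child => ∀ i, (child i).Closed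

/-- Provability by tableaux in Tm* of a formula over `Θ`: for both non-designated signs `L`, there
is a closed tableau starting from `L:φ`, over the signature obtained from `Θ` by adding
countably many new constants. -/
def Provable (φ : Formula Θ Θ.Const) : Prop :=
  ∀ L : Val, L = Val.F ∨ L = Val.f →
    ∃ τ : Tableau [Node.signed L (φ.map (Sum.inl : Θ.Const → Θ.Const ⊕ ℕ))], τ.Closed

/-- Provability by tableaux in Tm* of `φ` from a finite set `Γ`: for every enumeration
`γ₁, …, γₙ` of `Γ`, the formula `γ₁ → (γ₂ → … → (γₙ → φ) …)` is provable. -/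
def ProvableFrom (Γ : Finset (Formula Θ Θ.Const)) (φ : Formula Θ Θ.Const) : Prop :=
  ∀ l : List (Formula Θ Θ.Const), (∀ γ, γ ∈ l ↔ γ ∈ Γ) → Provable (l.foldr Formula.imp φ)

end Tableaux

end TmStar

/-!
Completeness is proved contrapositively: a tableau for `L:ψ` that cannot be closed yields a
structure and a valuation giving `ψ` the value `L`.

*A Hintikka set.* If no tableau extending a branch is closed, then every applicable rule has an
outcome for which the same is true (`OpenBranch.exists_append`). Applying the rules fairly, for all
constants of a countable infinite set `R`, gives an increasing chain of branches whose union `H`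
contains an outcome of the rule for each of its members, and in which variants have equal signs
(`OpenBranch.exists_hintikka`). Restricting the instances to the constants in `R`, namely the
constants of `ψ` and the new ones, keeps the construction countable for every signature.

*The valuation.* A valuation is total and must respect variants, whereas `H` gives signs to some
formulas only. The value `eval R H φ` is defined by recursion on the size of `φ`: it is the sign of
any variant of `φ` in `H`, and failing that a value chosen by a fixed function of the values of the
constituents. Negation and void quantifiers are the exceptions, since a variant of `φ` may have
other leading negations and void quantifiers than `φ` has (already `¬¬φ` is a variant of `φ`): these
are evaluated deterministically. Therefore `eval` respects variants
(`eval_subst_eq_of_variant`, an induction on the derivation of the variant relation that carries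
along a substitution of constants).

*Signs are admissible.* It remains to see that a sign taken over from `H` for `φ` obeys the
multioperators, although the rules act on the variant of `φ` in `H` and not on `φ`. To this end the
set `admissible R H φ` of values permitted by the multioperators is defined so as to look through
negations and void quantifiers. It is invariant under variants too (`admissible_eq_of_variant`), and
contains every sign of `φ` in `H` (`Hintikka.mem_admissible`). No normal form of variants is needed.

Finally, the constants of `Θ` that do not occur in `ψ` are interpreted by one element named in `R`.
-/

namespace TmStar

universe u w

/-! ### The chain of truth values -/

namespace Val

/-- The involution of the truth values induced by negation. -/
def neg : Val → Val
  | T => F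
  | t => f
  | f => t
  | F => T

/-- The position of a truth value in the chain `F < f < t < T`. -/
def rank : Val → ℕ
  | F => 0
  | f => 1
  | t => 2
  | T => 3

theorem neg_neg (a : Val) : a.neg.neg = a := by cases a <;> rfl

theorem neg_mem_negOp (a : Val) : a.neg ∈ negOp a := by cases a <;> rfl

/-- A value chosen from `boxOp a`. -/
def box : Val → Val
  | T => T
  | _ => F

theorem box_mem_boxOp (a : Val) : a.box ∈ boxOp a := by cases a <;> simp [box, boxOp]

/-- A value chosen from `impOp a b`. -/
def imp : Val → Val → Val
  | T, b => b
  | t, f => f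
  | t, F => f
  | f, F => t
  | _, _ => T

theorem imp_mem_impOp (a b : Val) : a.imp b ∈ impOp a b := by
  cases a <;> cases b <;> simp [imp, impOp]

open Classical in
/-- The least element of a nonempty set of truth values. -/
noncomputable def min (X : Set Val) : Val :=
  if F ∈ X then F else if f ∈ X then f else if t ∈ X then t else T

open Classical in
/-- An element of `X`, or `a` if `X` is empty. -/
noncomputable def someOr (X : Set Val) (a : Val) : Val :=
  if h : X.Nonempty then h.some else a

theorem min_mem_allOp (X : Set Val) : min X ∈ allOp X := by
  unfold min allOp
  split_ifs <;> rfl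

theorem mem_allOp {X : Set Val} {a : Val} (ha : a ∈ X) (h : ∀ b ∈ X, a.rank ≤ b.rank) :
    a ∈ allOp X := by
  have key : ∀ b, b ∈ X → ¬ b.rank < a.rank := fun b hb => not_lt.2 (h b hb)
  unfold allOp
  have h0 := key F
  have h1 := key f
  have h2 := key t
  cases a <;> simp_all [rank]

theorem allOp_singleton (a : Val) : allOp {a} = {a} := by
  cases a <;> simp [allOp]

end Val

section Formulas

variable {Θ : Signature.{u, w}} {K K' : Type u}

namespace Formula

/-! ### Substitution -/

/-- The number of connectives and quantifiers. Unlike `sizeOf`, it is invariant under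
substitution. -/
def size : Formula Θ K → ℕ
  | atom _ _ => 0
  | neg φ => φ.size + 1
  | box φ => φ.size + 1
  | imp φ ψ => φ.size + ψ.size + 1
  | all _ φ => φ.size + 1

@[simp]
theorem size_subst (φ : Formula Θ K) (s : ℕ → Term K) : (φ.subst s).size = φ.size := by
  induction φ generalizing s <;> simp_all [subst, size]

@[simp]
theorem size_inst (φ : Formula Θ K) (x : ℕ) (c : K) : (φ.inst x c).size = φ.size :=
  size_subst _ _

theorem subst_congr {φ : Formula Θ K} {s s' : ℕ → Term K} (h : ∀ n, φ.Free n → s n = s' n) :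
    φ.subst s = φ.subst s' := by
  induction φ generalizing s s' with
  | atom P ts =>
    simp only [subst, atom.injEq, heq_eq_eq, true_and]
    funext i
    cases hi : ts i with
    | var n => exact h n ⟨i, hi⟩
    | const c => rfl
  | neg φ ih => exact congrArg neg (ih h)
  | box φ ih => exact congrArg box (ih h)
  | imp φ ψ ih₁ ih₂ =>
    exact congrArg₂ imp (ih₁ fun n hn => h n (Or.inl hn)) (ih₂ fun n hn => h n (Or.inr hn))
  | all x φ ih =>
    refine congrArg (all x) (ih fun n hn => ?_)
    by_cases hnx : n = x
    · subst hnx; simp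
    · simp [hnx, h n ⟨hnx, hn⟩]

theorem subst_var (φ : Formula Θ K) : φ.subst Term.var = φ := by
  induction φ with
  | atom P ts =>
    simp only [subst, atom.injEq, heq_eq_eq, true_and]
    funext i
    cases ts i <;> rfl
  | neg φ ih => exact congrArg neg ih
  | box φ ih => exact congrArg box ih
  | imp φ ψ ih₁ ih₂ => exact congrArg₂ imp ih₁ ih₂
  | all x φ ih => simpa [subst] using ih

theorem subst_eq_self {φ : Formula Θ K} {s : ℕ → Term K} (h : ∀ n, φ.Free n → s n = .var n) :
    φ.subst s = φ :=
  (subst_congr h).trans φ.subst_var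

theorem subst_update_of_not_free {φ : Formula Θ K} {x : ℕ} (h : ¬ φ.Free x) (s : ℕ → Term K)
    (τ : Term K) : φ.subst (Function.update s x τ) = φ.subst s :=
  subst_congr fun n hn => Function.update_of_ne (fun e : n = x => h (e ▸ hn)) _ _

theorem subst₁_of_not_free {φ : Formula Θ K} {x : ℕ} (h : ¬ φ.Free x) (τ : Term K) :
    φ.subst₁ x τ = φ :=
  (subst_update_of_not_free h _ τ).trans φ.subst_var

theorem inst_of_not_free {φ : Formula Θ K} {x : ℕ} (h : ¬ φ.Free x) (c : K) :
    φ.inst x c = φ :=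
  subst₁_of_not_free h _

/-- A substitution that replaces some variables by constants and fixes the others. Such a
substitution never causes variable capture. -/
def ConstSubst (s : ℕ → Term K) : Prop := ∀ n, s n = .var n ∨ ∃ c, s n = .const c

theorem constSubst_var : ConstSubst (Term.var : ℕ → Term K) := fun _ => Or.inl rfl

theorem ConstSubst.update_var {s : ℕ → Term K} (hs : ConstSubst s) (x : ℕ) :
    ConstSubst (Function.update s x (.var x)) := by
  intro n
  by_cases h : n = x
  · subst h; simp
  · simpa [h] using hs n

theorem ConstSubst.update_const {s : ℕ → Term K} (hs : ConstSubst s) (x : ℕ) (c : K) :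
    ConstSubst (Function.update s x (.const c)) := by
  intro n
  by_cases h : n = x
  · subst h; simp
  · simpa [h] using hs n

theorem free_subst_iff {s : ℕ → Term K} (hs : ConstSubst s) (φ : Formula Θ K) (n : ℕ) :
    (φ.subst s).Free n ↔ φ.Free n ∧ s n = .var n := by
  induction φ generalizing s with
  | atom P ts =>
    simp only [subst, Free]
    constructor
    · rintro ⟨i, hi⟩
      cases hti : ts i with
      | var m =>
        rw [hti] at hi
        change s m = _ at hi
        rcases hs m with h | ⟨c, h⟩
        · obtain rfl : m = n := by simpa [h] using hi
          exact ⟨⟨i, hti⟩, h⟩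
        · simp [h] at hi
      | const c => simp [hti, Term.subst] at hi
    · rintro ⟨⟨i, hi⟩, h⟩
      exact ⟨i, by rw [hi]; exact h⟩
  | neg φ ih => exact ih hs
  | box φ ih => exact ih hs
  | imp φ ψ ih₁ ih₂ => simp only [subst, Free, ih₁ hs, ih₂ hs, or_and_right]
  | all x φ ih =>
    simp only [subst, Free, ih (hs.update_var x)]
    by_cases h : n = x
    · simp [h]
    · simp [h]

theorem freeFor_subst {s : ℕ → Term K} (hs : ConstSubst s) {φ : Formula Θ K} {x y : ℕ}
    (h : φ.FreeFor x y) : (φ.subst s).FreeFor x y := by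
  induction φ generalizing s with
  | atom P ts => trivial
  | neg φ ih => exact ih hs h
  | box φ ih => exact ih hs h
  | imp φ ψ ih₁ ih₂ => exact ⟨ih₁ hs h.1, ih₂ hs h.2⟩
  | all z φ ih =>
    intro hx
    have := h ((free_subst_iff hs (all z φ) x).1 hx).1
    exact ⟨this.1, ih (hs.update_var z) this.2⟩

theorem subst_subst {s : ℕ → Term K} (hs : ConstSubst s) (φ : Formula Θ K) (r : ℕ → Term K) :
    (φ.subst s).subst r = φ.subst fun n => (s n).subst r := by
  induction φ generalizing s r with
  | atom P ts =>
    simp only [subst, atom.injEq, heq_eq_eq, true_and]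
    funext i
    cases ts i <;> rfl
  | neg φ ih => exact congrArg neg (ih hs r)
  | box φ ih => exact congrArg box (ih hs r)
  | imp φ ψ ih₁ ih₂ => exact congrArg₂ imp (ih₁ hs r) (ih₂ hs r)
  | all x φ ih =>
    refine congrArg (all x) ((ih (hs.update_var x) _).trans (subst_congr fun n _ => ?_))
    by_cases h : n = x
    · subst h; simp [Term.subst]
    · rcases hs n with e | ⟨c, e⟩ <;> simp [h, e, Term.subst]

theorem subst_rename {φ : Formula Θ K} {x y : ℕ} (h : φ.FreeFor x y) (r : ℕ → Term K) :
    (φ.subst₁ x (.var y)).subst r = φ.subst (Function.update r x (r y)) := by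
  unfold subst₁
  induction φ generalizing r with
  | atom P ts =>
    simp only [subst, atom.injEq, heq_eq_eq, true_and]
    funext i
    cases ts i with
    | var n =>
      by_cases hn : n = x
      · subst hn; simp [Term.subst]
      · simp [hn, Term.subst]
    | const c => rfl
  | neg φ ih => exact congrArg neg (ih h r)
  | box φ ih => exact congrArg box (ih h r)
  | imp φ ψ ih₁ ih₂ => exact congrArg₂ imp (ih₁ h.1 r) (ih₂ h.2 r)
  | all z φ ih =>
    by_cases hx : (all z φ).Free x
    · obtain ⟨hzy, hφ⟩ := h hx
      have hxz : x ≠ z := hx.1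
      refine congrArg (all z) ?_
      have e : Function.update (Function.update Term.var x (Term.var y : Term K)) z (.var z) =
          Function.update Term.var x (.var y) := by
        rw [Function.update_comm hxz, Function.update_eq_self]
      rw [e, ih hφ, Function.update_of_ne hzy.symm, Function.update_comm hxz]
    · rw [subst_update_of_not_free hx, subst_var, subst_update_of_not_free hx]

theorem inst_rename {φ : Formula Θ K} {x y : ℕ} (hy : ¬ φ.Free y) (h : φ.FreeFor x y) (c : K) :
    (φ.subst₁ x (.var y)).inst y c = φ.inst x c := by
  refine (subst_rename h _).trans (subst_congr fun n hn => ?_)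
  have hny : n ≠ y := fun e => hy (e ▸ hn)
  by_cases hnx : n = x
  · subst hnx; simp
  · simp [hnx, hny]

theorem inst_subst_update {s : ℕ → Term K} (hs : ConstSubst s) (φ : Formula Θ K) (x : ℕ)
    (c : K) : (φ.subst (Function.update s x (.var x))).inst x c =
      φ.subst (Function.update s x (.const c)) := by
  refine (subst_subst (hs.update_var x) φ _).trans (subst_congr fun n _ => ?_)
  by_cases h : n = x
  · subst h; simp [Term.subst]
  · rcases hs n with e | ⟨d, e⟩ <;> simp [h, e, Term.subst]

theorem free_rename_iff {φ : Formula Θ K} {x y : ℕ} (h : φ.FreeFor x y) (n : ℕ) :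
    (φ.subst₁ x (.var y)).Free n ↔ (n ≠ x ∧ φ.Free n) ∨ (n = y ∧ φ.Free x) := by
  unfold subst₁
  induction φ with
  | atom P ts =>
    simp only [subst, Free]
    constructor
    · rintro ⟨i, hi⟩
      cases hti : ts i with
      | var m =>
        rw [hti] at hi
        by_cases hm : m = x
        · subst hm
          have hyn : y = n := by simpa [Term.subst] using hi
          exact Or.inr ⟨hyn.symm, i, hti⟩
        · obtain rfl : m = n := by simpa [Term.subst, hm] using hi
          exact Or.inl ⟨hm, i, hti⟩
      | const c => simp [hti, Term.subst] at hi
    · rintro (⟨hn, i, hi⟩ | ⟨rfl, i, hi⟩)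
      · exact ⟨i, by simp [hi, Term.subst, hn]⟩
      · exact ⟨i, by simp [hi, Term.subst]⟩
  | neg φ ih => exact ih h
  | box φ ih => exact ih h
  | imp φ ψ ih₁ ih₂ =>
    refine (or_congr (ih₁ h.1) (ih₂ h.2)).trans ?_
    rw [Free, Free, and_or_left, and_or_left]
    exact or_or_or_comm
  | all z φ ih =>
    by_cases hx : (all z φ).Free x
    · obtain ⟨hzy, hφ⟩ := h hx
      have hxz : x ≠ z := hx.1
      have e : Function.update (Function.update Term.var x (Term.var y : Term K)) z (.var z) =
          Function.update Term.var x (.var y) := by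
        rw [Function.update_comm hxz, Function.update_eq_self]
      simp only [subst, Free, e, ih hφ]
      constructor
      · rintro ⟨h₁, h₂ | h₂⟩
        · exact Or.inl ⟨h₂.1, h₁, h₂.2⟩
        · exact Or.inr ⟨h₂.1, hxz, h₂.2⟩
      · rintro (h₂ | h₂)
        · exact ⟨h₂.2.1, Or.inl ⟨h₂.1, h₂.2.2⟩⟩
        · exact ⟨h₂.1 ▸ hzy.symm, Or.inr ⟨h₂.1, h₂.2.2⟩⟩
    · rw [subst_update_of_not_free hx, subst_var]
      constructor
      · intro hn
        exact Or.inl ⟨fun e : n = x => hx (e ▸ hn), hn⟩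
      · rintro (hn | hn)
        · exact hn.2
        · exact absurd hn.2 hx

theorem free_rename_self_iff {φ : Formula Θ K} {x y : ℕ} (hy : ¬ φ.Free y)
    (h : φ.FreeFor x y) : (φ.subst₁ x (.var y)).Free y ↔ φ.Free x := by
  rw [free_rename_iff h]
  tauto

/-! ### Renaming of constants -/

theorem map_congr {φ : Formula Θ K} {g g' : K → K'} (h : ∀ c, φ.Occurs c → g c = g' c) :
    φ.map g = φ.map g' := by
  induction φ with
  | atom P ts =>
    simp only [map, atom.injEq, heq_eq_eq, true_and]
    funext i
    cases hi : ts i with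
    | var n => rfl
    | const c => exact congrArg Term.const (h c ⟨i, hi⟩)
  | neg φ ih => exact congrArg neg (ih h)
  | box φ ih => exact congrArg box (ih h)
  | imp φ ψ ih₁ ih₂ =>
    exact congrArg₂ imp (ih₁ fun n hn => h n (Or.inl hn)) (ih₂ fun n hn => h n (Or.inr hn))
  | all x φ ih => exact congrArg (all x) (ih h)

theorem map_map {K'' : Type u} (φ : Formula Θ K) (g : K → K') (g' : K' → K'') :
    (φ.map g).map g' = φ.map (g' ∘ g) := by
  induction φ with
  | atom P ts =>
    simp only [map, atom.injEq, heq_eq_eq, true_and]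
    funext i
    cases ts i <;> rfl
  | neg φ ih => exact congrArg neg ih
  | box φ ih => exact congrArg box ih
  | imp φ ψ ih₁ ih₂ => exact congrArg₂ imp ih₁ ih₂
  | all x φ ih => exact congrArg (all x) ih

theorem map_subst (g : K → K') (φ : Formula Θ K) (s : ℕ → Term K) :
    (φ.subst s).map g = (φ.map g).subst fun n => (s n).map g := by
  induction φ generalizing s with
  | atom P ts =>
    simp only [map, subst, atom.injEq, heq_eq_eq, true_and]
    funext i
    cases ts i <;> rfl
  | neg φ ih => exact congrArg neg (ih s)
  | box φ ih => exact congrArg box (ih s)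
  | imp φ ψ ih₁ ih₂ => exact congrArg₂ imp (ih₁ s) (ih₂ s)
  | all x φ ih =>
    refine congrArg (all x) ((ih _).trans (subst_congr fun n _ => ?_))
    by_cases h : n = x
    · subst h; simp [Term.map]
    · simp [h]

theorem map_subst₁ (g : K → K') (φ : Formula Θ K) (x : ℕ) (τ : Term K) :
    (φ.subst₁ x τ).map g = (φ.map g).subst₁ x (τ.map g) := by
  refine (map_subst g φ _).trans (subst_congr fun n _ => ?_)
  by_cases h : n = x
  · subst h; simp
  · simp [h, Term.map]

theorem map_inst (g : K → K') (φ : Formula Θ K) (x : ℕ) (c : K) :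
    (φ.inst x c).map g = (φ.map g).inst x (g c) :=
  map_subst₁ g φ x _

theorem free_map_iff (g : K → K') (φ : Formula Θ K) (n : ℕ) :
    (φ.map g).Free n ↔ φ.Free n := by
  induction φ with
  | atom P ts =>
    simp only [map, Free]
    refine exists_congr fun i => ?_
    cases ts i <;> simp [Term.map]
  | neg φ ih => exact ih
  | box φ ih => exact ih
  | imp φ ψ ih₁ ih₂ => exact or_congr ih₁ ih₂
  | all x φ ih => exact and_congr_right fun _ => ih

theorem freeFor_map (g : K → K') {φ : Formula Θ K} {x y : ℕ} (h : φ.FreeFor x y) :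
    (φ.map g).FreeFor x y := by
  induction φ with
  | atom P ts => trivial
  | neg φ ih => exact ih h
  | box φ ih => exact ih h
  | imp φ ψ ih₁ ih₂ => exact ⟨ih₁ h.1, ih₂ h.2⟩
  | all z φ ih =>
    intro hx
    have := h ((free_map_iff g (all z φ) x).1 hx)
    exact ⟨this.1, ih this.2⟩

theorem finite_occurs (φ : Formula Θ K) : {c | φ.Occurs c}.Finite := by
  induction φ with
  | atom P ts =>
    have : {c | (atom P ts).Occurs c} ⊆ ⋃ i, {c | ts i = Term.const c} := by
      rintro c ⟨i, hi⟩
      exact Set.mem_iUnion.2 ⟨i, hi⟩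
    refine (Set.finite_iUnion fun i => Set.Subsingleton.finite ?_).subset this
    intro c hc d hd
    simpa using (hc : ts i = .const c).symm.trans hd
  | neg φ ih => exact ih
  | box φ ih => exact ih
  | imp φ ψ ih₁ ih₂ => exact ih₁.union ih₂
  | all x φ ih => exact ih

/-! ### Variants -/

theorem Variant.free_iff {φ ψ : Formula Θ K} (h : φ.Variant ψ) (n : ℕ) :
    φ.Free n ↔ ψ.Free n := by
  induction h with
  | refl φ => rfl
  | symm _ ih => exact ih.symm
  | trans _ _ ih₁ ih₂ => exact ih₁.trans ih₂
  | void_all hx => exact ⟨fun h => h.2, fun h => ⟨fun e => hx (e ▸ h), h⟩⟩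
  | void_ex hx => exact ⟨fun h => h.2, fun h => ⟨fun e => hx (e ▸ h), h⟩⟩
  | @rename x y φ hy hf =>
    simp only [Free, free_rename_iff hf]
    constructor
    · rintro ⟨h₁, h₂⟩
      exact ⟨fun e => hy (e ▸ h₂), Or.inl ⟨h₁, h₂⟩⟩
    · rintro ⟨h₁, h₂ | h₂⟩
      · exact h₂
      · exact absurd h₂.1 h₁
  | neg _ ih => exact ih
  | box _ ih => exact ih
  | imp _ _ ih₁ ih₂ => exact or_congr ih₁ ih₂
  | all _ ih => exact and_congr_right fun _ => ih

theorem Variant.map (g : K → K') {φ ψ : Formula Θ K} (h : φ.Variant ψ) :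
    (φ.map g).Variant (ψ.map g) := by
  induction h with
  | refl φ => exact .refl _
  | symm _ ih => exact ih.symm
  | trans _ _ ih₁ ih₂ => exact ih₁.trans ih₂
  | void_all hx => exact .void_all (mt (free_map_iff g _ _).1 hx)
  | void_ex hx => exact .void_ex (mt (free_map_iff g _ _).1 hx)
  | rename hy hf =>
    have := Variant.rename (mt (free_map_iff g _ _).1 hy) (freeFor_map g hf)
    simpa only [Formula.map, map_subst₁, Term.map] using this
  | neg _ ih => exact .neg ih
  | box _ ih => exact .box ih
  | imp _ _ ih₁ ih₂ => exact .imp ih₁ ih₂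
  | all _ ih => exact .all ih

theorem rename_subst {s : ℕ → Term K} (hs : ConstSubst s) {φ : Formula Θ K} {x y : ℕ}
    (hy : ¬ φ.Free y) (hf : φ.FreeFor x y) :
    (φ.subst₁ x (.var y)).subst (Function.update s y (.var y)) =
      (φ.subst (Function.update s x (.var x))).subst₁ x (.var y) := by
  rw [subst_rename hf, subst₁, subst_subst (hs.update_var x)]
  refine subst_congr fun n hn => ?_
  have hny : n ≠ y := fun e => hy (e ▸ hn)
  by_cases hnx : n = x
  · subst hnx; simp [Term.subst]
  · rcases hs n with e | ⟨d, e⟩ <;> simp [hnx, hny, e, Term.subst]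

theorem Variant.subst {φ ψ : Formula Θ K} (h : φ.Variant ψ) {s : ℕ → Term K}
    (hs : ConstSubst s) : (φ.subst s).Variant (ψ.subst s) := by
  induction h generalizing s with
  | refl φ => exact .refl _
  | symm _ ih => exact (ih hs).symm
  | trans _ _ ih₁ ih₂ => exact (ih₁ hs).trans (ih₂ hs)
  | @void_all x φ hx =>
    rw [← subst_update_of_not_free hx s (.var x)]
    exact .void_all fun h => hx ((free_subst_iff (hs.update_var x) φ x).1 h).1
  | @void_ex x φ hx =>
    rw [← subst_update_of_not_free hx s (.var x)]
    exact .void_ex fun h => hx ((free_subst_iff (hs.update_var x) φ x).1 h).1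
  | @rename x y φ hy hf =>
    have := Variant.rename (fun h => hy ((free_subst_iff (hs.update_var x) φ y).1 h).1)
      (freeFor_subst (hs.update_var x) hf)
    simpa only [Formula.subst, rename_subst hs hy hf] using this
  | neg _ ih => exact .neg (ih hs)
  | box _ ih => exact .box (ih hs)
  | imp _ _ ih₁ ih₂ => exact .imp (ih₁ hs) (ih₂ hs)
  | all _ ih => exact .all (ih (hs.update_var _))

end Formula

end Formulas

/-! ### Hintikka sets -/

section Hintikka

variable {Θ : Signature.{u, w}} {K : Type u}

open Node Formula

/-- The entry `N` has been dealt with in the set `S` of entries: some outcome of the rule for `N`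
is in `S`. For a quantified formula, an instance witnessing the sign must be present, and,
unless the sign is the least one, the instance with the constant `c` must be present with a
sign that is not smaller. -/
def Expanded (R : Set K) (S : Set (Node Θ K)) (c : K) : Node Θ K → Prop
  | signed L (.neg φ) => signed L.neg φ ∈ S
  | signed L (.box φ) => ∃ a, signed a φ ∈ S ∧ L ∈ boxOp a
  | signed L (.imp φ ψ) =>
      (∃ a, signed a φ ∈ S ∧ ∀ b, L ∈ impOp a b) ∨ (∃ b, signed b ψ ∈ S ∧ ∀ a, L ∈ impOp a b) ∨
        ∃ a b, signed a φ ∈ S ∧ signed b ψ ∈ S ∧ L ∈ impOp a b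
  | signed L (.all x φ) =>
      (∃ d ∈ R, signed L (φ.inst x d) ∈ S) ∧
        (L = .F ∨ ∃ a, signed a (φ.inst x c) ∈ S ∧ L.rank ≤ a.rank)
  | _ => True

theorem Expanded.mono {R : Set K} {S S' : Set (Node Θ K)} (h : S ⊆ S') {c : K} {N : Node Θ K}
    (hN : Expanded R S c N) : Expanded R S' c N := by
  cases N with
  | marked => trivial
  | signed L φ =>
    cases φ with
    | atom => trivial
    | neg φ => exact h hN
    | box φ => exact hN.imp fun a ha => ⟨h ha.1, ha.2⟩
    | imp φ ψ =>
      exact hN.imp (fun ⟨a, ha⟩ => ⟨a, h ha.1, ha.2⟩)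
        (Or.imp (fun ⟨a, ha⟩ => ⟨a, h ha.1, ha.2⟩)
          fun ⟨a, b, hab⟩ => ⟨a, b, h hab.1, h hab.2.1, hab.2.2⟩)
    | all x φ =>
      exact ⟨hN.1.imp fun d hd => ⟨hd.1, h hd.2⟩,
        hN.2.imp id fun ⟨a, ha⟩ => ⟨a, h ha.1, ha.2⟩⟩

/-- A set of entries in which variants have equal signs and every entry has been dealt with, for
all constants in `R`. -/
structure Hintikka (R : Set K) (H : Set (Node Θ K)) : Prop where
  consistent : ∀ {L L' φ φ'}, signed L φ ∈ H → signed L' φ' ∈ H → φ.Variant φ' → L = L'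
  expanded : ∀ N ∈ H, ∀ c ∈ R, Expanded R H c N

/-- A branch without a closed tableau, all of whose marks record an instance, with a constant of
`R`, that is on the branch. -/
structure OpenBranch (R : Set K) (θ : List (Node Θ K)) : Prop where
  not_closed : ∀ τ : Tableau θ, ¬ τ.Closed
  mark : ∀ {L x φ c}, marked L x φ c ∈ θ → signed L (φ.inst x c) ∈ θ ∧ c ∈ R

theorem exists_append_not_closed {θ : List (Node Θ K)} (h : ∀ τ : Tableau θ, ¬ τ.Closed)
    {es : List (List (Node Θ K))} (hr : Rule θ es) :
    ∃ e ∈ es, ∀ τ : Tableau (θ ++ e), ¬ τ.Closed := by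
  by_contra! hc
  choose τ hτ using fun i : Fin es.length => hc (es.get i) (List.get_mem _ _)
  exact h (.step θ es hr τ) hτ

/-- An application of a rule extends an open branch to an open branch, provided that the marks
it adds come with the instances they record. -/
theorem OpenBranch.exists_append {R : Set K} {θ : List (Node Θ K)} (h : OpenBranch R θ)
    {es : List (List (Node Θ K))} (hr : Rule θ es)
    (hm : ∀ e ∈ es, ∀ L x φ c, marked L x φ c ∈ e → signed L (φ.inst x c) ∈ e ∧ c ∈ R) :
    ∃ e ∈ es, OpenBranch R (θ ++ e) := by
  obtain ⟨e, he, hτ⟩ := exists_append_not_closed h.not_closed hr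
  refine ⟨e, he, hτ, fun {L x φ c} hc => ?_⟩
  rcases List.mem_append.1 hc with hc | hc
  · exact ⟨List.mem_append_left _ (h.mark hc).1, (h.mark hc).2⟩
  · exact ⟨List.mem_append_right _ (hm e he _ _ _ _ hc).1, (hm e he _ _ _ _ hc).2⟩

theorem finite_occurs_branch (θ : List (Node Θ K)) : {c | ∃ N ∈ θ, N.Occurs c}.Finite := by
  have : {c | ∃ N ∈ θ, N.Occurs c} = ⋃ N ∈ {N | N ∈ θ}, {c | N.Occurs c} := by
    ext; simp
  rw [this]
  refine (List.finite_toSet θ).biUnion fun N _ => ?_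
  cases N with
  | signed L φ => exact φ.finite_occurs
  | marked L x φ d => exact φ.finite_occurs.union (Set.finite_singleton d)

theorem exists_fresh {R : Set K} (hR : R.Infinite) (θ : List (Node Θ K)) (c : K) :
    ∃ d ∈ R, Fresh d θ ∧ c ≠ d := by
  obtain ⟨d, hd, hn⟩ := (hR.sdiff ((finite_occurs_branch θ).insert c)).nonempty
  refine ⟨d, hd, fun N hN ho => hn (Or.inr ⟨N, hN, ho⟩), fun e => hn (Or.inl e.symm)⟩

theorem OpenBranch.exists_expanded {R : Set K} (hR : R.Infinite) {θ : List (Node Θ K)}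
    (h : OpenBranch R θ) {N : Node Θ K} (hN : N ∈ θ) {c : K} (hc : c ∈ R) :
    ∃ θ', θ ⊆ θ' ∧ OpenBranch R θ' ∧ Expanded R {M | M ∈ θ'} c N := by
  -- Apply a rule and check that each of its outcomes deals with `N`.
  have key : ∀ {es : List (List (Node Θ K))}, Rule θ es →
      (∀ e ∈ es, (∀ L x φ c, marked L x φ c ∈ e → signed L (φ.inst x c) ∈ e ∧ c ∈ R) ∧
        Expanded R {M | M ∈ θ ++ e} c N) →
      ∃ θ', θ ⊆ θ' ∧ OpenBranch R θ' ∧ Expanded R {M | M ∈ θ'} c N := by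
    intro es hr he
    obtain ⟨e, hes, ho⟩ := h.exists_append hr fun e hes => (he e hes).1
    exact ⟨θ ++ e, List.subset_append_left _ _, ho, (he e hes).2⟩
  cases N with
  | marked => exact ⟨θ, List.Subset.refl _, h, trivial⟩
  | signed L φ =>
    cases φ with
    | atom => exact ⟨θ, List.Subset.refl _, h, trivial⟩
    | neg φ =>
      cases L
      · exact key (.neg_T hN) (by simp [Expanded, Val.neg])
      · exact key (.neg_t hN) (by simp [Expanded, Val.neg])
      · exact key (.neg_f hN) (by simp [Expanded, Val.neg])
      · exact key (.neg_F hN) (by simp [Expanded, Val.neg])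
    | box φ =>
      cases L
      · refine key (.box_T hN) ?_
        simp only [List.forall_mem_cons]
        exact ⟨⟨by simp, .T, by simp, by simp [boxOp]⟩, by simp⟩
      · refine key (.box_t hN) ?_
        simp only [List.forall_mem_cons]
        exact ⟨⟨by simp, .T, by simp, by simp [boxOp]⟩, by simp⟩
      · refine key (.box_f hN) ?_
        simp only [List.forall_mem_cons]
        exact ⟨⟨by simp, .t, by simp, by simp [boxOp]⟩, ⟨by simp, .f, by simp, by simp [boxOp]⟩,
          ⟨by simp, .F, by simp, by simp [boxOp]⟩, by simp⟩
      · refine key (.box_F hN) ?_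
        simp only [List.forall_mem_cons]
        exact ⟨⟨by simp, .t, by simp, by simp [boxOp]⟩, ⟨by simp, .f, by simp, by simp [boxOp]⟩,
          ⟨by simp, .F, by simp, by simp [boxOp]⟩, by simp⟩
    | imp φ ψ =>
      have pair : ∀ a b : Val, L ∈ impOp a b →
          (∀ L x χ c, marked L x χ c ∈ [signed a φ, signed b ψ] →
            signed L (χ.inst x c) ∈ [signed a φ, signed b ψ] ∧ c ∈ R) ∧
          Expanded R {M | M ∈ θ ++ [signed a φ, signed b ψ]} c (signed L (imp φ ψ)) :=
        fun a b hab => ⟨by simp, Or.inr (Or.inr ⟨a, b, by simp, by simp, hab⟩)⟩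
      cases L
      · refine key (.imp_T hN) ?_
        simp only [List.forall_mem_cons]
        refine ⟨⟨by simp, Or.inl ⟨.F, by simp, fun b => by cases b <;> simp [impOp]⟩⟩,
          pair _ _ ?_, pair _ _ ?_, pair _ _ ?_,
          ⟨by simp, Or.inr (Or.inl ⟨.T, by simp, fun a => by cases a <;> simp [impOp]⟩)⟩,
          by simp⟩ <;> simp [impOp]
      · refine key (.imp_t hN) ?_
        simp only [List.forall_mem_cons]
        refine ⟨pair _ _ ?_, pair _ _ ?_, pair _ _ ?_, pair _ _ ?_, pair _ _ ?_, by simp⟩ <;>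
          simp [impOp]
      · refine key (.imp_f hN) ?_
        simp only [List.forall_mem_cons]
        refine ⟨pair _ _ ?_, pair _ _ ?_, pair _ _ ?_, by simp⟩ <;> simp [impOp]
      · refine key (.imp_F hN) ?_
        simp only [List.forall_mem_cons]
        refine ⟨pair _ _ ?_, by simp⟩
        simp [impOp]
    | all x φ =>
      -- If the first use of the rule is over, its mark provides the witness.
      by_cases hm : ∃ d, marked L x φ d ∈ θ
      · obtain ⟨d, hd⟩ := hm
        obtain ⟨hs, hdR⟩ := h.mark hd
        by_cases hcd : c = d
        · subst hcd
          exact ⟨θ, List.Subset.refl _, h, ⟨c, hc, hs⟩, Or.inr ⟨L, hs, le_rfl⟩⟩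
        have out : ∀ a : Val, L.rank ≤ a.rank →
            (∀ L y χ c', marked L y χ c' ∈ [signed a (φ.inst x c)] →
              signed L (χ.inst y c') ∈ [signed a (φ.inst x c)] ∧ c' ∈ R) ∧
            Expanded R {M | M ∈ θ ++ [signed a (φ.inst x c)]} c (signed L (all x φ)) :=
          fun a ha => ⟨by simp, ⟨d, hdR, by simp [hs]⟩, Or.inr ⟨a, by simp, ha⟩⟩
        cases L
        · refine key (.all_T c hN) ?_
          simp only [List.forall_mem_cons]
          exact ⟨out _ le_rfl, by simp⟩
        · refine key (.reuse_t c hd hcd) ?_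
          simp only [List.forall_mem_cons]
          exact ⟨out _ (by decide), out _ (by decide), by simp⟩
        · refine key (.reuse_f c hd hcd) ?_
          simp only [List.forall_mem_cons]
          exact ⟨out _ (by decide), out _ (by decide), out _ (by decide), by simp⟩
        · exact ⟨θ, List.Subset.refl _, h, ⟨d, hdR, hs⟩, Or.inl rfl⟩
      · have hm' : ∀ d, marked L x φ d ∉ θ := fun d hd => hm ⟨d, hd⟩
        obtain ⟨d, hdR, hd, hcd⟩ := exists_fresh hR θ c
        have out : ∀ a : Val, L.rank ≤ a.rank →
            (∀ L' y χ c', marked L' y χ c' ∈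
              [signed L (φ.inst x d), signed a (φ.inst x c), marked L x φ d] →
              signed L' (χ.inst y c') ∈
                [signed L (φ.inst x d), signed a (φ.inst x c), marked L x φ d] ∧ c' ∈ R) ∧
            Expanded R {M | M ∈ θ ++
              [signed L (φ.inst x d), signed a (φ.inst x c), marked L x φ d]} c
              (signed L (all x φ)) := by
          refine fun a ha => ⟨?_, ⟨d, hdR, by simp⟩, Or.inr ⟨a, by simp, ha⟩⟩
          intro L' y χ c' hmem
          obtain ⟨rfl, rfl, rfl, rfl⟩ : L' = L ∧ y = x ∧ χ = φ ∧ c' = d := by simpa using hmem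
          exact ⟨by simp, hdR⟩
        cases L
        · refine key (.all_T c hN) ?_
          simp only [List.forall_mem_cons]
          exact ⟨⟨by simp, ⟨c, hc, by simp⟩, Or.inr ⟨.T, by simp, le_rfl⟩⟩, by simp⟩
        · refine key (.all_t d c hN hm' hd hcd) ?_
          simp only [List.forall_mem_cons]
          exact ⟨out _ (by decide), out _ (by decide), by simp⟩
        · refine key (.all_f d c hN hm' hd hcd) ?_
          simp only [List.forall_mem_cons]
          exact ⟨out _ (by decide), out _ (by decide), out _ (by decide), by simp⟩
        · refine key (.all_F d hN hm' hd) ?_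
          simp only [List.forall_mem_cons]
          refine ⟨⟨?_, ⟨d, hdR, by simp⟩, Or.inl rfl⟩, by simp⟩
          intro L' y χ c' hmem
          obtain ⟨rfl, rfl, rfl, rfl⟩ : L' = .F ∧ y = x ∧ χ = φ ∧ c' = d := by simpa using hmem
          exact ⟨by simp, hdR⟩

theorem OpenBranch.exists_expanded_list {R : Set K} (hR : R.Infinite) {θ : List (Node Θ K)}
    (h : OpenBranch R θ) (l : List (Node Θ K × K)) (hl : ∀ p ∈ l, p.1 ∈ θ ∧ p.2 ∈ R) :
    ∃ θ', θ ⊆ θ' ∧ OpenBranch R θ' ∧ ∀ p ∈ l, Expanded R {M | M ∈ θ'} p.2 p.1 := by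
  induction l with
  | nil => exact ⟨θ, List.Subset.refl _, h, by simp⟩
  | cons p l ih =>
    rw [List.forall_mem_cons] at hl
    obtain ⟨θ₁, h₁, ho₁, he₁⟩ := ih hl.2
    obtain ⟨θ₂, h₂, ho₂, he₂⟩ := ho₁.exists_expanded hR (h₁ hl.1.1) hl.1.2
    refine ⟨θ₂, fun _ hM => h₂ (h₁ hM), ho₂, List.forall_mem_cons.2 ⟨he₂, fun q hq => ?_⟩⟩
    exact (he₁ q hq).mono fun _ hM => h₂ hM

/-- The union of a fair chain of open branches. At stage `n`, all entries present are expanded for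
the first `n` constants in an enumeration of `R`. -/
theorem OpenBranch.exists_hintikka {R : Set K} (hR : R.Infinite) (hRc : R.Countable)
    {θ : List (Node Θ K)} (h : OpenBranch R θ) : ∃ H, Hintikka R H ∧ ∀ N ∈ θ, N ∈ H := by
  obtain ⟨e, rfl⟩ := hRc.exists_eq_range hR.nonempty
  have step : ∀ (n : ℕ) (θ : {θ : List (Node Θ K) // OpenBranch (Set.range e) θ}),
      ∃ θ' : {θ : List (Node Θ K) // OpenBranch (Set.range e) θ}, θ.1 ⊆ θ'.1 ∧
        ∀ N ∈ θ.1, ∀ j < n, Expanded (Set.range e) {M | M ∈ θ'.1} (e j) N := by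
    rintro n ⟨θ, hθ⟩
    obtain ⟨θ', hs, ho, he⟩ := hθ.exists_expanded_list hR
      (θ ×ˢ (List.range n).map e) fun p hp => by
        obtain ⟨h₁, h₂⟩ := List.mem_product.1 hp
        obtain ⟨j, -, hj⟩ := List.mem_map.1 h₂
        exact ⟨h₁, j, hj⟩
    refine ⟨⟨θ', ho⟩, hs, fun N hN j hj => he (N, e j) ?_⟩
    exact List.mem_product.2 ⟨hN, List.mem_map.2 ⟨j, List.mem_range.2 hj, rfl⟩⟩
  choose next hsub hexp using step
  let b : ℕ → {θ : List (Node Θ K) // OpenBranch (Set.range e) θ} :=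
    fun n => Nat.rec ⟨θ, h⟩ next n
  have mono : ∀ {m n}, m ≤ n → (b m).1 ⊆ (b n).1 := by
    intro m n hmn
    induction hmn with
    | refl => exact List.Subset.refl _
    | step _ ih => exact fun _ hM => hsub _ _ (ih hM)
  refine ⟨{N | ∃ n, N ∈ (b n).1}, ⟨?_, ?_⟩, fun N hN => ⟨0, hN⟩⟩
  · rintro L L' φ φ' ⟨m, hm⟩ ⟨n, hn⟩ hv
    by_contra hne
    exact (b (max m n)).2.not_closed (.leaf _) ⟨L, L', φ, φ', mono (le_max_left m n) hm,
      mono (le_max_right m n) hn, hv, hne⟩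
  · rintro N ⟨m, hm⟩ _ ⟨j, rfl⟩
    have := hexp (max m (j + 1)) (b (max m (j + 1))) N (mono (le_max_left _ _) hm) j
      (lt_of_lt_of_le j.lt_succ_self (le_max_right _ _))
    refine this.mono (S' := {N | ∃ n, N ∈ (b n).1}) fun M hM => ?_
    exact ⟨max m (j + 1) + 1, hM⟩

end Hintikka

/-! ### The valuation given by a Hintikka set -/

section Evaluation

variable {Θ : Signature.{u, w}} {K : Type u}

open Node Formula

/-- The signs with which variants of `φ` occur in `H`. -/
def signs (H : Set (Node Θ K)) (φ : Formula Θ K) : Set Val :=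
  {L | ∃ φ', signed L φ' ∈ H ∧ φ'.Variant φ}

/-- The sign of a variant of `φ` in `H`, and `a` if no variant of `φ` occurs in `H`. -/
noncomputable def signOr (H : Set (Node Θ K)) (φ : Formula Θ K) (a : Val) : Val :=
  Val.someOr (signs H φ) a

theorem signOr_congr (H : Set (Node Θ K)) {φ ψ : Formula Θ K} (h : φ.Variant ψ) {a b : Val}
    (hab : a = b) : signOr H φ a = signOr H ψ b := by
  have : signs H φ = signs H ψ := by
    ext L
    exact exists_congr fun φ' =>
      and_congr_right fun _ => ⟨fun k => k.trans h, fun k => k.trans h.symm⟩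
  rw [signOr, signOr, this, hab]

theorem signOr_mem_or (H : Set (Node Θ K)) (φ : Formula Θ K) (a : Val) :
    signOr H φ a ∈ signs H φ ∨ signOr H φ a = a := by
  unfold signOr Val.someOr
  split_ifs with h
  · exact Or.inl h.some_mem
  · exact Or.inr rfl

theorem Hintikka.signOr_eq {R : Set K} {H : Set (Node Θ K)} (hH : Hintikka R H)
    {φ : Formula Θ K} {L : Val} (h : signed L φ ∈ H) (a : Val) : signOr H φ a = L := by
  have hne : (signs H φ).Nonempty := ⟨L, φ, h, .refl φ⟩
  rw [signOr, Val.someOr, dif_pos hne]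
  obtain ⟨φ', hφ', hv⟩ := hne.some_mem
  exact hH.consistent hφ' h hv

open Classical in
/-- The truth value of a formula determined by the Hintikka set `H`. Negations and void
quantifiers are transparent; any other formula takes the sign of its variants in `H`, if there
are any, and otherwise a fixed value admitted by the multioperator of its main symbol, where the
quantifiers range over the constants in `R`. -/
noncomputable def eval (R : Set K) (H : Set (Node Θ K)) : Formula Θ K → Val
  | .atom P ts => signOr H (.atom P ts) .F
  | .neg φ => (eval R H φ).neg
  | .box φ => signOr H (.box φ) (eval R H φ).box
  | .imp φ ψ => signOr H (.imp φ ψ) ((eval R H φ).imp (eval R H ψ))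
  | .all x φ =>
      if φ.Free x then
        signOr H (.all x φ) (Val.min ((fun c => eval R H (φ.inst x c)) '' R))
      else eval R H φ
termination_by φ => φ.size
decreasing_by all_goals simp only [size_inst, size]; omega

variable (R : Set K) (H : Set (Node Θ K))

theorem eval_all_of_free {φ : Formula Θ K} {x : ℕ} (h : φ.Free x) :
    eval R H (.all x φ) =
      signOr H (.all x φ) (Val.min ((fun c => eval R H (φ.inst x c)) '' R)) := by
  rw [eval, if_pos h]

theorem eval_all_of_not_free {φ : Formula Θ K} {x : ℕ} (h : ¬ φ.Free x) :
    eval R H (.all x φ) = eval R H φ := by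
  rw [eval, if_neg h]

/-- Invariance under variants. The substitution `s` is what makes the induction pass through the
quantifiers, whose values depend on the instances of their scopes. -/
theorem eval_subst_eq_of_variant {φ ψ : Formula Θ K} (h : φ.Variant ψ) {s : ℕ → Term K}
    (hs : ConstSubst s) : eval R H (φ.subst s) = eval R H (ψ.subst s) := by
  induction h generalizing s with
  | refl φ => rfl
  | symm _ ih => exact (ih hs).symm
  | trans _ _ ih₁ ih₂ => exact (ih₁ hs).trans (ih₂ hs)
  | @void_all x φ hx =>
    rw [← subst_update_of_not_free hx s (.var x)]
    exact eval_all_of_not_free R H fun h => hx ((free_subst_iff (hs.update_var x) φ x).1 h).1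
  | @void_ex x φ hx =>
    have hx' : ¬ (Formula.neg (φ.subst (Function.update s x (.var x)))).Free x :=
      fun h => hx ((free_subst_iff (hs.update_var x) φ x).1 h).1
    rw [← subst_update_of_not_free hx s (.var x), ex, Formula.subst, Formula.subst,
      Formula.subst, eval, eval_all_of_not_free R H hx', eval, Val.neg_neg]
  | @rename x y φ hy hf =>
    simp only [Formula.subst, rename_subst hs hy hf]
    have hy' : ¬ (φ.subst (Function.update s x (.var x))).Free y :=
      fun h => hy ((free_subst_iff (hs.update_var x) φ y).1 h).1
    have hf' := freeFor_subst (hs.update_var x) hf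
    by_cases hx : (φ.subst (Function.update s x (.var x))).Free x
    · rw [eval_all_of_free R H hx,
        eval_all_of_free R H ((free_rename_self_iff hy' hf').2 hx)]
      simp only [inst_rename hy' hf']
      exact signOr_congr H (.rename hy' hf') rfl
    · rw [eval_all_of_not_free R H hx,
        eval_all_of_not_free R H (mt (free_rename_self_iff hy' hf').1 hx),
        subst₁_of_not_free hx]
  | neg _ ih => rw [Formula.subst, Formula.subst, eval, eval, ih hs]
  | box hv ih =>
    rw [Formula.subst, Formula.subst, eval, eval]
    exact signOr_congr H (.box (hv.subst hs)) (by rw [ih hs])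
  | imp hv₁ hv₂ ih₁ ih₂ =>
    rw [Formula.subst, Formula.subst, eval, eval]
    exact signOr_congr H (.imp (hv₁.subst hs) (hv₂.subst hs)) (by rw [ih₁ hs, ih₂ hs])
  | @all x φ ψ hv ih =>
    have hv' := hv.subst (hs.update_var x)
    rw [Formula.subst, Formula.subst]
    by_cases hx : (φ.subst (Function.update s x (.var x))).Free x
    · rw [eval_all_of_free R H hx, eval_all_of_free R H ((hv'.free_iff x).1 hx)]
      refine signOr_congr H (.all hv') (congrArg (fun k : K → Val => Val.min (k '' R)) ?_)
      funext c
      rw [inst_subst_update hs, inst_subst_update hs]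
      exact ih (hs.update_const x c)
    · rw [eval_all_of_not_free R H hx, eval_all_of_not_free R H (mt (hv'.free_iff x).2 hx)]
      exact ih (hs.update_var x)

theorem eval_eq_of_variant {φ ψ : Formula Θ K} (h : φ.Variant ψ) :
    eval R H φ = eval R H ψ := by
  simpa only [subst_var] using eval_subst_eq_of_variant R H h constSubst_var

open Classical in
/-- The values that the multioperators admit for a formula, given the values of the immediate
constituents of what is left of it when leading negations and void quantifiers are removed. -/
noncomputable def admissible : Formula Θ K → Set Val
  | .atom _ _ => Set.univ
  | .neg φ => {a | a.neg ∈ admissible φ}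
  | .box φ => boxOp (eval R H φ)
  | .imp φ ψ => impOp (eval R H φ) (eval R H ψ)
  | .all x φ =>
      if φ.Free x then allOp ((fun c => eval R H (φ.inst x c)) '' R) else admissible φ

theorem admissible_all_of_free {φ : Formula Θ K} {x : ℕ} (h : φ.Free x) :
    admissible R H (.all x φ) = allOp ((fun c => eval R H (φ.inst x c)) '' R) := by
  rw [admissible, if_pos h]

theorem admissible_all_of_not_free {φ : Formula Θ K} {x : ℕ} (h : ¬ φ.Free x) :
    admissible R H (.all x φ) = admissible R H φ := by
  rw [admissible, if_neg h]

theorem admissible_eq_of_variant {φ ψ : Formula Θ K} (h : φ.Variant ψ) :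
    admissible R H φ = admissible R H ψ := by
  induction h with
  | refl φ => rfl
  | symm _ ih => exact ih.symm
  | trans _ _ ih₁ ih₂ => exact ih₁.trans ih₂
  | void_all hx => exact admissible_all_of_not_free R H hx
  | @void_ex x φ hx =>
    have hx' : ¬ (Formula.neg φ).Free x := hx
    rw [ex, admissible, admissible_all_of_not_free R H hx', admissible]
    simp only [Set.mem_ofPred_eq, Val.neg_neg, Set.ofPred_mem_eq]
  | @rename x y φ hy hf =>
    by_cases hx : φ.Free x
    · rw [admissible_all_of_free R H hx,
        admissible_all_of_free R H ((free_rename_self_iff hy hf).2 hx)]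
      simp only [inst_rename hy hf]
    · rw [admissible_all_of_not_free R H hx,
        admissible_all_of_not_free R H (mt (free_rename_self_iff hy hf).1 hx),
        subst₁_of_not_free hx]
  | neg _ ih => rw [admissible, admissible, ih]
  | box hv _ => rw [admissible, admissible, eval_eq_of_variant R H hv]
  | imp hv₁ hv₂ _ _ =>
    rw [admissible, admissible, eval_eq_of_variant R H hv₁, eval_eq_of_variant R H hv₂]
  | @all x φ ψ hv ih =>
    by_cases hx : φ.Free x
    · rw [admissible_all_of_free R H hx, admissible_all_of_free R H ((hv.free_iff x).1 hx)]
      have e : (fun c => eval R H (φ.inst x c)) = fun c => eval R H (ψ.inst x c) := by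
        funext c
        exact eval_subst_eq_of_variant R H hv (constSubst_var.update_const x c)
      rw [e]
    · rw [admissible_all_of_not_free R H hx,
        admissible_all_of_not_free R H (mt (hv.free_iff x).2 hx), ih]

variable {R H}

theorem Hintikka.eval_eq (hH : Hintikka R H) (hR : R.Nonempty) {L : Val} {φ : Formula Θ K}
    (h : signed L φ ∈ H) : eval R H φ = L := by
  obtain ⟨c, hc⟩ := hR
  induction φ generalizing L with
  | atom P ts => rw [eval, hH.signOr_eq h]
  | neg φ ih =>
    have : signed L.neg φ ∈ H := hH.expanded _ h c hc
    rw [eval, ih this, Val.neg_neg]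
  | box φ => rw [eval, hH.signOr_eq h]
  | imp φ ψ => rw [eval, hH.signOr_eq h]
  | all x φ ih =>
    by_cases hx : φ.Free x
    · rw [eval_all_of_free R H hx, hH.signOr_eq h]
    · obtain ⟨⟨d, _, hd⟩, _⟩ := hH.expanded _ h c hc
      rw [inst_of_not_free hx] at hd
      rw [eval_all_of_not_free R H hx, ih hd]

theorem Hintikka.mem_admissible (hH : Hintikka R H) (hR : R.Nonempty) {L : Val}
    {φ : Formula Θ K} (h : signed L φ ∈ H) : L ∈ admissible R H φ := by
  obtain ⟨c, hc⟩ := hR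
  have he : ∀ {a χ}, signed a χ ∈ H → eval R H χ = a := hH.eval_eq ⟨c, hc⟩
  induction φ generalizing L with
  | atom P ts => trivial
  | neg φ ih => exact ih (hH.expanded _ h c hc)
  | box φ =>
    obtain ⟨a, ha, hL⟩ := hH.expanded _ h c hc
    rwa [admissible, he ha]
  | imp φ ψ =>
    rw [admissible]
    rcases hH.expanded _ h c hc with ⟨a, ha, hL⟩ | ⟨b, hb, hL⟩ | ⟨a, b, ha, hb, hL⟩
    · rw [he ha]; exact hL _
    · rw [he hb]; exact hL _
    · rwa [he ha, he hb]
  | all x φ ih =>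
    obtain ⟨⟨d, hdR, hd⟩, _⟩ := hH.expanded _ h c hc
    by_cases hx : φ.Free x
    · rw [admissible_all_of_free R H hx]
      refine Val.mem_allOp ⟨d, hdR, he hd⟩ ?_
      rintro _ ⟨c', hc', rfl⟩
      rcases (hH.expanded _ h c' hc').2 with rfl | ⟨a, ha, hle⟩
      · exact Nat.zero_le _
      · simpa only [he ha] using hle
    · rw [inst_of_not_free hx] at hd
      rw [admissible_all_of_not_free R H hx]
      exact ih hd

/-- A sign occurring in `H` for some variant of `φ` is admissible for that variant, hence for
`φ`. -/
theorem Hintikka.signOr_mem (hH : Hintikka R H) (hR : R.Nonempty) {φ : Formula Θ K} {a : Val}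
    (ha : a ∈ admissible R H φ) : signOr H φ a ∈ admissible R H φ := by
  rcases signOr_mem_or H φ a with ⟨φ', hφ', hv⟩ | h
  · rw [← admissible_eq_of_variant R H hv]
    exact hH.mem_admissible hR hφ'
  · rwa [h]

theorem Hintikka.eval_box_mem (hH : Hintikka R H) (hR : R.Nonempty) (φ : Formula Θ K) :
    eval R H (.box φ) ∈ boxOp (eval R H φ) := by
  have := hH.signOr_mem hR (φ := .box φ) (a := (eval R H φ).box)
    (by rw [admissible]; exact Val.box_mem_boxOp _)
  rwa [eval, ← admissible]

theorem Hintikka.eval_imp_mem (hH : Hintikka R H) (hR : R.Nonempty) (φ ψ : Formula Θ K) :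
    eval R H (.imp φ ψ) ∈ impOp (eval R H φ) (eval R H ψ) := by
  have := hH.signOr_mem hR (φ := .imp φ ψ) (a := (eval R H φ).imp (eval R H ψ))
    (by rw [admissible]; exact Val.imp_mem_impOp _ _)
  rwa [eval, ← admissible]

theorem Hintikka.eval_all_mem (hH : Hintikka R H) (hR : R.Nonempty) (x : ℕ) (φ : Formula Θ K) :
    eval R H (.all x φ) ∈ allOp ((fun c => eval R H (φ.inst x c)) '' R) := by
  by_cases hx : φ.Free x
  · have := hH.signOr_mem hR (φ := .all x φ)
      (a := Val.min ((fun c => eval R H (φ.inst x c)) '' R))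
      (by rw [admissible_all_of_free R H hx]; exact Val.min_mem_allOp _)
    rwa [eval_all_of_free R H hx, ← admissible_all_of_free R H hx]
  · simp only [inst_of_not_free hx, hR.image_const, eval_all_of_not_free R H hx,
      Val.allOp_singleton, Set.mem_singleton_iff]

/-- If the constants of the diagram signature of `A` name exactly the constants in `R`, in
accordance with the atoms, then `eval` induces a valuation over `A`. -/
theorem Hintikka.isValuation (hH : Hintikka R H) (hR : R.Nonempty) (A : ModalStructure Θ)
    (g : A.DiagConst → K) (hg : Set.range g = R)
    (hA : ∀ P (c : Fin (Θ.arity P) → A.DiagConst),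
      A.pred P (fun i => A.interp (c i)) = eval R H (.atom P fun i => .const (g (c i)))) :
    A.IsValuation fun χ => eval R H (χ.map g) where
  atom P c := (hA P c).symm
  neg φ _ := by
    simp only [Formula.map]
    rw [eval]
    exact Val.neg_mem_negOp _
  box φ _ := hH.eval_box_mem hR _
  imp φ ψ _ _ := hH.eval_imp_mem hR _ _
  all x φ _ := by
    have := hH.eval_all_mem hR x (φ.map g)
    rw [← hg, ← Set.range_comp] at this
    simpa only [Function.comp_def, map_inst, hg, Formula.map] using this
  variant φ ψ _ _ h := eval_eq_of_variant R H (h.map g)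

/-- A nested implication is undesignated only if its premises are designated and its conclusion
is not. -/
theorem Hintikka.designated_of_foldr_imp (hH : Hintikka R H) (hR : R.Nonempty) {K₀ : Type u}
    (g : K₀ → K) (φ : Formula Θ K₀) (l : List (Formula Θ K₀))
    (h : ¬ Designated (eval R H ((l.foldr Formula.imp φ).map g))) :
    (∀ γ ∈ l, Designated (eval R H (γ.map g))) ∧ ¬ Designated (eval R H (φ.map g)) := by
  induction l with
  | nil => exact ⟨by simp, h⟩
  | cons γ l ih =>
    have key : ∀ a b c : Val, c ∈ impOp a b → ¬ Designated c → Designated a ∧ ¬ Designated b := by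
      intro a b c
      cases a <;> cases b <;> cases c <;> simp [impOp, Designated]
    obtain ⟨h₁, h₂⟩ := key _ _ _ (hH.eval_imp_mem hR _ _) h
    exact ⟨List.forall_mem_cons.2 ⟨h₁, (ih h₂).1⟩, (ih h₂).2⟩

end Evaluation

theorem ModalStructure.lift_subst_of_closed {Θ : Signature.{u, w}} (A : ModalStructure Θ)
    {φ : Formula Θ Θ.Const} (h : φ.Closed) (s : ℕ → Term A.DiagConst) :
    (A.lift φ).subst s = A.lift φ :=
  Formula.subst_eq_self fun n hn => absurd ((Formula.free_map_iff _ φ n).1 hn) (h n)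

end TmStar

open TmStar in
theorem mainTheorem2 {Θ : TmStar.Signature} (Γ : Finset (TmStar.Formula Θ Θ.Const))
    (φ : TmStar.Formula Θ Θ.Const) (hΓ : ∀ γ ∈ Γ, γ.Closed) (hφ : φ.Closed)
    (h : TmStar.SemCons (Γ : Set (TmStar.Formula Θ Θ.Const)) φ) :
    TmStar.ProvableFrom Γ φ := by
  classical
  intro l hl L hL
  by_contra! hτ
  set ψ := l.foldr Formula.imp φ with hψ
  -- `Θ` may be uncountable, but only countably many constants matter.
  let R : Set (Θ.Const ⊕ ℕ) := Sum.inl '' {c | ψ.Occurs c} ∪ Set.range Sum.inr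
  have hRi : R.Infinite := (Set.infinite_range_of_injective Sum.inr_injective).mono
    Set.subset_union_right
  have hRc : R.Countable := (ψ.finite_occurs.image _).countable.union (Set.countable_range _)
  have hR := hRi.nonempty
  obtain ⟨H, hH, hmem⟩ := OpenBranch.exists_hintikka (R := R) hRi hRc
    (θ := [Node.signed L (ψ.map Sum.inl)]) ⟨hτ, by simp⟩
  -- The irrelevant constants denote the same element as a relevant one.
  let r : Θ.Const ⊕ ℕ → Θ.Const ⊕ ℕ := fun c => if c ∈ R then c else Sum.inr 0
  have hr : Set.range r = R := by
    refine Set.Subset.antisymm ?_ fun c hc => ⟨c, if_pos hc⟩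
    rintro _ ⟨c, rfl⟩
    by_cases hc : c ∈ R
    · rwa [show r c = c from if_pos hc]
    · rw [show r c = Sum.inr 0 from if_neg hc]
      exact Or.inr ⟨0, rfl⟩
  let A : ModalStructure Θ :=
    { U := Θ.Const ⊕ ℕ
      nonempty := ⟨Sum.inr 0⟩
      pred := fun P us => eval R H (.atom P fun i => .const (r (us i)))
      const := Sum.inl }
  have hA : Function.Surjective A.interp := by
    rintro (c | n)
    · exact ⟨Sum.inl c, rfl⟩
    · exact ⟨Sum.inr ⟨Sum.inr n, by simp [A]⟩, rfl⟩
  have hv := hH.isValuation hR A (r ∘ A.interp) (by rw [hA.range_comp, hr]) fun P c => rfl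
  have hlift : ∀ χ : Formula Θ Θ.Const, (A.lift χ).map (r ∘ A.interp) = χ.map (r ∘ Sum.inl) :=
    fun χ => Formula.map_map χ _ _
  have hψL : eval R H (ψ.map (r ∘ Sum.inl)) = L := by
    have e : ψ.map (r ∘ Sum.inl) = ψ.map Sum.inl :=
      Formula.map_congr fun c hc => if_pos (Or.inl ⟨c, hc, rfl⟩)
    rw [e]
    exact hH.eval_eq hR (hmem _ (by simp))
  obtain ⟨h₁, h₂⟩ := hH.designated_of_foldr_imp hR (r ∘ (Sum.inl : Θ.Const → Θ.Const ⊕ ℕ)) φ l (by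
    rw [← hψ, hψL]
    rcases hL with rfl | rfl <;> simp [Designated])
  have := h A _ hv (fun γ hγ s => by
    rw [A.lift_subst_of_closed (hΓ γ hγ), hlift]
    exact h₁ γ ((hl γ).2 hγ)) fun _ => Sum.inr ⟨Sum.inr 0, by simp [A]⟩
  rw [A.lift_subst_of_closed hφ, hlift] at this
  exact h₂ this
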